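/- All lattices are finite. For a convex subset $C$ of a lattice $L$, let $I(C)=\{y\in L : y\le x \text{ for some } x\in C\}$; the doubling $L[C]$ is the subposet $(I(C)\times\{0\})\cup\big(((L\setminus I(C))\cup C)\times\{1\}\big)$ of $L\times\{0<1\}$, which is again a lattice. A lattice is congruence uniform if, up to isomorphism, it is obtained from the one-element lattice by successively doubling nonempty closed intervals. Let $L$ be a congruence uniform lattice. Then the following are equivalent: (i) $L$ is extremal: the maximal length $n$ of a chain $x_0<x_1<\dots<x_n$ in $L$ equals both the number of join-irreducible elements of $L$ (the elements that cover exactly one element) and the number of meet-irreducible elements of $L$ (the elements that are covered by exactly one element). (ii) $L$ is left modular: $L$ has a maximal chain all of whose elements $a$ satisfy $(b\vee a)\wedge c=b\vee(a\wedge c)$ for all $b<c$ in $L$. (iii) $L$ is EL-shellable: the cover relations of $L$ can be labelled by elements of some poset so that in every interval $[x,y]$ of $L$ there is exactly one maximal chain whose labels, read from bottom to top, are (weakly) increasing, and the label word of this chain lexicographically precedes the label word of every other maximal chain of $[x,y]$. (iv) $L$ is shellable: the maximal chains of $L$ (the facets of its order complex) can be listed without repetition as $F_1,\dots,F_k$ so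 that for every $1\le j<k$ the simplicial complex $\big(\bigcup_{i=1}^{j}\langle F_i\rangle\big)\cap\langle F_{j+1}\rangle$ is pure of dimension $\dim(F_{j+1})-1$, where $\langle F\rangle$ is the set of all subsets of $F$ (the empty face included) and $\dim(F)=|F|-1$. -/

import Mathlib

universe u

/-! ### Extremal lattices -/

/-- The join-irreducible elements: those that cover exactly one element. -/
def joinIrreducibles (L : Type u) [Lattice L] : Set L := {j | ∃! x, x ⋖ j}

/-- The meet-irreducible elements: those that are covered by exactly one element. -/
def meetIrreducibles (L : Type u) [Lattice L] : Set L := {m | ∃! x, m ⋖ x}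

/-- A finite lattice is extremal if its length (the largest `n` such that there is a chain
`x₀ < x₁ < ⋯ < xₙ`; this is `Order.krullDim L`) equals both the number of its join-irreducible
elements and the number of its meet-irreducible elements. -/
def IsExtremal (L : Type u) [Lattice L] : Prop :=
  Order.krullDim L = ((joinIrreducibles L).ncard : WithBot ℕ∞) ∧
    Order.krullDim L = ((meetIrreducibles L).ncard : WithBot ℕ∞)

/-! ### Left modular lattices -/

/-- An element `a` is left modular if `(b ⊔ a) ⊓ c = b ⊔ (a ⊓ c)` for all `b < c`. -/
def IsLeftModularElement {L : Type u} [Lattice L] (a : L) : Prop :=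
  ∀ b c : L, b < c → (b ⊔ a) ⊓ c = b ⊔ (a ⊓ c)

/-- A lattice is left modular if it has a maximal chain made of left modular elements
(`Flag L` is the type of maximal chains of `L`). -/
def IsLeftModularLattice (L : Type u) [Lattice L] : Prop :=
  ∃ F : Flag L, ∀ a ∈ F, IsLeftModularElement a

/-! ### Congruence uniform lattices -/

/-- Day's doubling `L[C]`: the subposet
`(I(C) × {0}) ∪ (((L \ I(C)) ∪ C) × {1})` of `L × {0 < 1}`, where `I(C)` is the order ideal
generated by `C` and the two-element chain `0 < 1` is `Bool` with `false < true`. -/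
def Doubling {L : Type u} [PartialOrder L] (C : Set L) : Type u :=
  {p : L × Bool // (p.1 ∈ lowerClosure C ∧ p.2 = false) ∨
    ((p.1 ∉ lowerClosure C ∨ p.1 ∈ C) ∧ p.2 = true)}

/-- The order on `L[C]` is the one induced by the product order on `L × {0 < 1}`. -/
instance Doubling.instPartialOrder {L : Type u} [PartialOrder L] (C : Set L) :
    PartialOrder (Doubling C) :=
  Subtype.partialOrder _

/-- A lattice is congruence uniform if it is obtained, up to isomorphism, from the one-element
lattice by successive doublings of nonempty closed intervals. -/
inductive IsCongruenceUniform : (L : Type u) → [Lattice L] → Prop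
  | one (L : Type u) [Lattice L] (hne : Nonempty L) (hsub : Subsingleton L) :
      IsCongruenceUniform L
  | doubling (M L : Type u) [Lattice M] [Lattice L] (hM : IsCongruenceUniform M)
      (a b : M) (hab : a ≤ b) (e : L ≃o Doubling (Set.Icc a b)) :
      IsCongruenceUniform L

/-! ### Edge-labellings and EL-shellability -/

/-- The set `E(L)` of cover relations (edges of the Hasse diagram). -/
abbrev CoverEdge (L : Type u) [Lattice L] : Type u := {e : L × L // e.1 ⋖ e.2}

/-- Saturated chains `x₀ ⋖ x₁ ⋖ ⋯ ⋖ xₙ`. In a finite lattice the maximal chains of an interval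
`[x, y]` are exactly the saturated chains with first element `x` and last element `y`. -/
abbrev SaturatedChain (L : Type u) [Lattice L] : Type u :=
  RelSeries {e : L × L | e.1 ⋖ e.2}

/-- The word of labels read along a saturated chain from bottom to top. -/
def labelWord {L : Type u} [Lattice L] {P : Type} (γ : CoverEdge L → P)
    (s : SaturatedChain L) : List P :=
  List.ofFn fun i : Fin s.length => γ ⟨(s i.castSucc, s i.succ), s.step i⟩

/-- A saturated chain is increasing if its word of labels `p₁, …, pₙ` satisfies
`p₁ ≤ p₂ ≤ ⋯ ≤ pₙ`. -/
def IsIncreasingChain {L : Type u} [Lattice L] {P : Type} [PartialOrder P]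
    (γ : CoverEdge L → P) (s : SaturatedChain L) : Prop :=
  (labelWord γ s).IsChain (· ≤ ·)

/-- An edge-labelling with values in a poset is an EL-labelling if every interval `[x, y]` has a
unique increasing maximal chain, and the word of that chain lexicographically precedes the word
of every other maximal chain of `[x, y]`. -/
def IsELLabelling {L : Type u} [Lattice L] {P : Type} [PartialOrder P]
    (γ : CoverEdge L → P) : Prop :=
  ∀ x y : L, x ≤ y →
    ∃ s : SaturatedChain L, (s.head = x ∧ s.last = y) ∧ IsIncreasingChain γ s ∧
      ∀ t : SaturatedChain L, t.head = x → t.last = y → t ≠ s →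
        ¬ IsIncreasingChain γ t ∧ List.Lex (· < ·) (labelWord γ s) (labelWord γ t)

/-- A finite lattice is EL-shellable if it admits an EL-labelling. (A finite lattice has finitely
many edges, so that label posets in `Type` are general enough.) -/
def IsELShellable (L : Type u) [Lattice L] : Prop :=
  ∃ (P : Type) (_ : PartialOrder P) (γ : CoverEdge L → P), IsELLabelling γ

/-! ### Shellability -/

/-- The order complex of a poset: its faces are the nonempty finite chains. -/
def orderComplex (P : Type u) [PartialOrder P] : AbstractSimplicialComplex P where
  faces := {F | F.Nonempty ∧ IsChain (· ≤ ·) (F : Set P)}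
  isRelLowerSet_faces := fun _ hF =>
    ⟨hF.1, fun _ hGF hG => ⟨hG, hF.2.mono (Finset.coe_subset.mpr hGF)⟩⟩
  singleton_mem := fun v =>
    ⟨Finset.singleton_nonempty v, by simp⟩

/-- A facet of a simplicial complex is a face that is maximal under inclusion. -/
def IsFacet {V : Type u} (K : AbstractSimplicialComplex V) (F : Finset V) : Prop :=
  Maximal (· ∈ K.faces) F

/-- The dimension `|F| - 1` of a face `F`; the empty face has dimension `-1`. -/
def faceDim {V : Type u} (F : Finset V) : ℤ := (F.card : ℤ) - 1

/-- A family of faces is pure of dimension `d` if all its maximal members have dimension `d`. -/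
def IsPureOfDim {V : Type u} (S : Set (Finset V)) (d : ℤ) : Prop :=
  ∀ G, Maximal (· ∈ S) G → faceDim G = d

/-- A finite simplicial complex is shellable (not necessarily pure) if its facets can be listed
without repetition as `F₀, …, F₍ₖ₋₁₎` in such a way that for every `0 < j < k` the complex
`(⋃_{i < j} ⟨Fᵢ⟩) ∩ ⟨Fⱼ⟩` is pure of dimension `dim Fⱼ - 1`. Here `⟨F⟩` consists of all the subsets
of `F`, the empty one included. -/
def IsShellable {V : Type u} (K : AbstractSimplicialComplex V) : Prop :=
  ∃ (k : ℕ) (F : Fin k → Finset V), Function.Injective F ∧ (∀ G, IsFacet K G ↔ ∃ i, F i = G) ∧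
    ∀ j : Fin k, 0 < (j : ℕ) →
      IsPureOfDim ((⋃ i ∈ Set.Iio j, {G | G ⊆ F i}) ∩ {G | G ⊆ F j}) (faceDim (F j) - 1)

/-- A lattice is shellable if its order complex is shellable. -/
def IsShellableLattice (L : Type u) [Lattice L] : Prop := IsShellable (orderComplex L)

/-! Congruence uniformity is used only through nonemptiness and join and meet semidistributivity;
the latter survive the doubling of an interval. The conditions are then linked in a cycle.

Extremal to left modular: each step of a longest chain picks up a new join-irreducible element, and
equality of the counts makes every join-irreducible arise at exactly one step. If left modularity
failed at a chain element, some join-irreducible `j` would satisfy `j ⊓ b₁ = j ⊓ b₂` and `j ≤ b₁ ⊔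
b₂` without `j ≤ b₁`, against meet semidistributivity.

Left modular to EL-shellable: `Flag.coverLabel` works. With `a` the least chain element such that `¬
a ⊓ z ≤ y`, the increasing chain of `[y, z]` starts with `y ⊔ (a ⊓ z)`, an atom by
`IsLeftModularElement.covBy_sup_inf`.

EL-shellable to shellable: maximal chains are compared by the labels at their first divergence;
every linear extension of this partial order is a shelling, since a descent of a chain can be
exchanged for an earlier chain.

Shellable to extremal: join semidistributivity gives each cover relation a join label. A maximal
chain containing all but one element of another carries all labels of the latter, so the first facet
carries all join-irreducibles and is at least that long. Duality handles the meet-irreducibles. -/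

/-! ### Semidistributivity of congruence uniform lattices -/

/-- A lattice is join semidistributive if `x ⊔ y = x ⊔ z` implies `x ⊔ (y ⊓ z) = x ⊔ y`. -/
def IsJoinSemidistributive (L : Type u) [Lattice L] : Prop :=
  ∀ x y z : L, x ⊔ y = x ⊔ z → x ⊔ (y ⊓ z) = x ⊔ y

/-- A lattice is meet semidistributive if `x ⊓ y = x ⊓ z` implies `x ⊓ (y ⊔ z) = x ⊓ y`. -/
def IsMeetSemidistributive (L : Type u) [Lattice L] : Prop :=
  ∀ x y z : L, x ⊓ y = x ⊓ z → x ⊓ (y ⊔ z) = x ⊓ y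

theorem IsMeetSemidistributive.orderDual {L : Type u} [Lattice L]
    (h : IsMeetSemidistributive L) : IsJoinSemidistributive Lᵒᵈ := h

namespace Doubling

variable {M L : Type u} [Lattice M] [Lattice L] {a b : M}

/-- The pairs that belong to the doubling of `Set.Icc a b`. -/
theorem mem_Icc_iff (hab : a ≤ b) (m : M) (s : Bool) :
    ((m ∈ lowerClosure (Set.Icc a b) ∧ s = false) ∨
      ((m ∉ lowerClosure (Set.Icc a b) ∨ m ∈ Set.Icc a b) ∧ s = true)) ↔
    ((s = false → m ≤ b) ∧ (s = true → m ≤ b → a ≤ m)) := by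
  have h : m ∈ lowerClosure (Set.Icc a b) ↔ m ≤ b := by
    rw [mem_lowerClosure]
    exact ⟨fun ⟨c, hc, hm⟩ => hm.trans hc.2, fun hm => ⟨b, ⟨hab, le_rfl⟩, hm⟩⟩
  rw [h, Set.mem_Icc]
  cases s <;> simp; tauto

/-- In coordinates, joins in the doubling of an interval are taken componentwise. -/
theorem val_sup (hab : a ≤ b) (e : L ≃o Doubling (Set.Icc a b)) (x y : L) :
    (e (x ⊔ y)).1 = (e x).1 ⊔ (e y).1 := by
  have hx := (mem_Icc_iff hab _ _).1 (e x).2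
  have hy := (mem_Icc_iff hab _ _).1 (e y).2
  have hd : ((e x).1 ⊔ (e y).1).2 = ((e x).1.2 || (e y).1.2) := rfl
  have h1 : ((e x).1 ⊔ (e y).1).1 = (e x).1.1 ⊔ (e y).1.1 := rfl
  let d : Doubling (Set.Icc a b) := ⟨(e x).1 ⊔ (e y).1, (mem_Icc_iff hab _ _).2 (by
    rw [hd, h1]
    constructor
    · intro h
      rw [Bool.or_eq_false_iff] at h
      exact sup_le (hx.1 h.1) (hy.1 h.2)
    · intro h hle
      rw [Bool.or_eq_true] at h
      rcases h with h | h
      · exact (hx.2 h (le_sup_left.trans hle)).trans le_sup_left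
      · exact (hy.2 h (le_sup_right.trans hle)).trans le_sup_right)⟩
  apply le_antisymm
  · have hxy : x ⊔ y ≤ e.symm d := sup_le
      (e.le_symm_apply.2 (show (e x).1 ≤ _ from le_sup_left))
      (e.le_symm_apply.2 (show (e y).1 ≤ _ from le_sup_right))
    exact e.le_symm_apply.1 hxy
  · exact sup_le (e.monotone le_sup_left) (e.monotone le_sup_right)

/-- In coordinates, the first component of a meet in the doubling of an interval is the meet of
the first components, and the second component is as large as possible. -/
theorem val_inf (hab : a ≤ b) (e : L ≃o Doubling (Set.Icc a b)) (x y : L) :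
    (e (x ⊓ y)).1.1 = (e x).1.1 ⊓ (e y).1.1 ∧
      ((e (x ⊓ y)).1.2 = true ↔ (e x).1.2 = true ∧ (e y).1.2 = true ∧
        ((e x).1.1 ⊓ (e y).1.1 ≤ b → a ≤ (e x).1.1 ⊓ (e y).1.1)) := by
  classical
  have hx := (mem_Icc_iff hab _ _).1 (e x).2
  have hy := (mem_Icc_iff hab _ _).1 (e y).2
  set m := (e x).1.1 ⊓ (e y).1.1 with hm
  -- The last conjunct says that `(m, true)` belongs to the doubling.
  let s : Bool := decide ((e x).1.2 = true ∧ (e y).1.2 = true ∧ (m ≤ b → a ≤ m))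
  have hs : s = true ↔ (e x).1.2 = true ∧ (e y).1.2 = true ∧ (m ≤ b → a ≤ m) :=
    decide_eq_true_iff
  let d : Doubling (Set.Icc a b) := ⟨(m, s), (mem_Icc_iff hab _ _).2 (by
    constructor
    · intro h
      by_contra hb
      have h' : ¬ s = true := by simpa using h
      rw [hs] at h'
      apply h'
      refine ⟨?_, ?_, fun h => absurd h hb⟩
      · by_contra h
        exact hb (inf_le_left.trans (hx.1 (by simpa using h)))
      · by_contra h
        exact hb (inf_le_right.trans (hy.1 (by simpa using h)))
    · intro h
      exact (hs.1 h).2.2)⟩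
  have hle : ∀ p q : M × Bool, p ≤ q ↔ p.1 ≤ q.1 ∧ (p.2 = true → q.2 = true) := fun p q => by
    rw [Prod.le_def, Bool.le_iff_imp]
  have key : (e (x ⊓ y)).1 = (m, s) := by
    have h1 : (e (x ⊓ y)).1 ≤ (e x).1 := e.monotone inf_le_left
    have h2 : (e (x ⊓ y)).1 ≤ (e y).1 := e.monotone inf_le_right
    have h3 := (mem_Icc_iff hab _ _).1 (e (x ⊓ y)).2
    have h4 : e.symm d ≤ x ⊓ y := le_inf
      (e.symm_apply_le.2 ((hle _ _).2 ⟨inf_le_left, fun h => (hs.1 h).1⟩))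
      (e.symm_apply_le.2 ((hle _ _).2 ⟨inf_le_right, fun h => (hs.1 h).2.1⟩))
    have h5 : (m, s) ≤ (e (x ⊓ y)).1 := e.symm_apply_le.1 h4
    rw [hle] at h1 h2
    have h6 : (e (x ⊓ y)).1.1 = m := le_antisymm (le_inf h1.1 h2.1) ((hle _ _).1 h5).1
    refine le_antisymm ((hle _ _).2 ⟨h6.le, fun h => ?_⟩) h5
    exact hs.2 ⟨h1.2 h, h2.2 h, h6 ▸ h3.2 h⟩
  rw [key]
  exact ⟨rfl, hs⟩

/-- Only the second components need an argument, and only when that of `x` is `false`, so that `x`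
lies below `b`. The meet of `y` and `z` could lose the value `true` only by falling below `b`
outside `[a, b]`; but then `x ⊔ y` lies below `b`, which forces `y` and `z` above `a`. -/
theorem isJoinSemidistributive (hab : a ≤ b) (e : L ≃o Doubling (Set.Icc a b))
    (hM : IsJoinSemidistributive M) : IsJoinSemidistributive L := by
  intro x y z h
  apply e.injective
  apply Subtype.ext
  have h' := congrArg (fun w => (e w).1) h
  simp only [val_sup hab] at h' ⊢
  have h1 : (e x).1.1 ⊔ (e y).1.1 = (e x).1.1 ⊔ (e z).1.1 := congrArg Prod.fst h'
  have h2 : ((e x).1.2 || (e y).1.2) = ((e x).1.2 || (e z).1.2) := congrArg Prod.snd h'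
  have hi := val_inf hab e y z
  have hm := hM _ _ _ h1
  refine Prod.ext ?_ ?_
  · rw [Prod.fst_sup, Prod.fst_sup, hi.1, hm]
  · rw [Prod.snd_sup, Prod.snd_sup]
    have hx := (mem_Icc_iff hab _ _).1 (e x).2
    have hy := (mem_Icc_iff hab _ _).1 (e y).2
    have hz := (mem_Icc_iff hab _ _).1 (e z).2
    change ((e x).1.2 || _) = ((e x).1.2 || _)
    rcases Bool.eq_false_or_eq_true (e x).1.2 with hsx | hsx
    · simp [hsx]
    · simp only [hsx, Bool.false_or] at h2 ⊢
      rw [Bool.eq_iff_iff, hi.2, ← h2]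
      refine ⟨fun h => h.1, fun hsy => ⟨hsy, hsy, fun hle => ?_⟩⟩
      have hyz : (e x).1.1 ⊔ (e y).1.1 ≤ b := by
        rw [← hm]; exact sup_le (hx.1 hsx) hle
      exact le_inf (hy.2 hsy (le_sup_right.trans hyz))
        (hz.2 (h2 ▸ hsy) (le_sup_right.trans (h1 ▸ hyz)))

/-- The three meets share their first component, hence also the condition for the second component
`true` to be admissible there. -/
theorem isMeetSemidistributive (hab : a ≤ b) (e : L ≃o Doubling (Set.Icc a b))
    (hM : IsMeetSemidistributive M) : IsMeetSemidistributive L := by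
  intro x y z h
  apply e.injective
  apply Subtype.ext
  have hxy := val_inf hab e x y
  have hxz := val_inf hab e x z
  have hj := val_inf hab e x (y ⊔ z)
  rw [val_sup hab] at hj
  have h1 : (e x).1.1 ⊓ (e y).1.1 = (e x).1.1 ⊓ (e z).1.1 := by
    rw [← hxy.1, ← hxz.1, h]
  have hm : (e x).1.1 ⊓ ((e y).1 ⊔ (e z).1).1 = (e x).1.1 ⊓ (e y).1.1 := hM _ _ _ h1
  have hs : ((e y).1 ⊔ (e z).1).2 = ((e y).1.2 || (e z).1.2) := rfl
  rw [hm, hs] at hj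
  rw [← h, ← h1] at hxz
  refine Prod.ext ?_ ?_
  · rw [hj.1, hxy.1]
  · rw [Bool.eq_iff_iff, hj.2, hxy.2, Bool.or_eq_true]
    constructor
    · rintro ⟨hx, hy | hz, hp⟩
      · exact ⟨hx, hy, hp⟩
      · exact hxy.2.1 (hxz.2.2 ⟨hx, hz, hp⟩)
    · rintro ⟨hx, hy, hp⟩
      exact ⟨hx, Or.inl hy, hp⟩

end Doubling

theorem IsCongruenceUniform.semidistributive {L : Type u} [Lattice L]
    (hL : IsCongruenceUniform L) : IsJoinSemidistributive L ∧ IsMeetSemidistributive L := by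
  induction hL with
  | one L _ hsub => exact ⟨fun _ _ _ _ => Subsingleton.elim _ _, fun _ _ _ _ => Subsingleton.elim _ _⟩
  | doubling M L hM a b hab e ih =>
    exact ⟨Doubling.isJoinSemidistributive hab e ih.1, Doubling.isMeetSemidistributive hab e ih.2⟩

theorem IsCongruenceUniform.nonempty {L : Type u} [Lattice L]
    (hL : IsCongruenceUniform L) : Nonempty L := by
  induction hL with
  | one L hne hsub => exact hne
  | doubling M L hM a b hab e ih =>
    exact ⟨e.symm ⟨(b, false), (Doubling.mem_Icc_iff hab _ _).2 ⟨fun _ => le_rfl, by simp⟩⟩⟩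

/-! ### Maximal chains -/

namespace IsMaxChain

variable {L : Type u} [PartialOrder L] {c : Set L}

theorem mem_of_comparable (hc : IsMaxChain (· ≤ ·) c) {a : L}
    (h : ∀ b ∈ c, a ≤ b ∨ b ≤ a) : a ∈ c := by
  have := hc.2 (hc.1.insert fun b hb _ => h b hb) (Set.subset_insert a c)
  rw [this]
  exact Set.mem_insert _ _

theorem le_or_le (hc : IsMaxChain (· ≤ ·) c) {a b : L} (ha : a ∈ c) (hb : b ∈ c) :
    a ≤ b ∨ b ≤ a := hc.1.total ha hb

theorem lt_or_le (hc : IsMaxChain (· ≤ ·) c) {a b : L} (ha : a ∈ c) (hb : b ∈ c) :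
    a < b ∨ b ≤ a := by
  rcases hc.le_or_le ha hb with h | h
  · rcases h.lt_or_eq with h | h
    · exact Or.inl h
    · exact Or.inr h.ge
  · exact Or.inr h

theorem eq_of_covBy (hc : IsMaxChain (· ≤ ·) c) {u a b : L} (ha : a ∈ c) (hb : b ∈ c)
    (hua : u ⋖ a) (hub : u ⋖ b) : a = b := by
  rcases hc.le_or_le ha hb with h | h
  · exact hub.eq_or_eq hua.le h |>.resolve_left hua.ne'
  · exact (hua.eq_or_eq hub.le h |>.resolve_left hub.ne').symm

theorem le_of_covBy_of_lt (hc : IsMaxChain (· ≤ ·) c) {u a b : L} (ha : a ∈ c) (hb : b ∈ c)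
    (hua : u ⋖ a) (hub : u < b) : a ≤ b := by
  rcases hc.lt_or_le hb ha with h | h
  · exact absurd h (hua.2 hub)
  · exact h

theorem dual (hc : IsMaxChain (· ≤ ·) c) :
    IsMaxChain (α := Lᵒᵈ) (· ≤ ·) (OrderDual.ofDual ⁻¹' c) := hc.symm

variable [Finite L]

/-- An element strictly between `u` and the next element of `c` would be comparable with all of `c`,
hence belong to `c`. -/
theorem exists_covBy_le (hc : IsMaxChain (· ≤ ·) c) {u v : L} (hu : u ∈ c) (hv : v ∈ c)
    (huv : u < v) : ∃ a ∈ c, u ⋖ a ∧ a ≤ v := by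
  obtain ⟨a, hav, ha⟩ := (Set.toFinite {a | a ∈ c ∧ u < a}).exists_le_minimal
    (show v ∈ {a | a ∈ c ∧ u < a} from ⟨hv, huv⟩)
  refine ⟨a, ha.prop.1, ⟨ha.prop.2, fun w huw hwa => ?_⟩, hav⟩
  have hw : w ∈ c := hc.mem_of_comparable fun b hb => by
    rcases hc.lt_or_le hu hb with h | h
    · rcases hc.le_or_le ha.prop.1 hb with h' | h'
      · exact Or.inl (hwa.le.trans h')
      · exact Or.inl (hwa.le.trans (ha.le_of_le ⟨hb, h⟩ h'))
    · exact Or.inr (h.trans huw.le)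
  exact hwa.not_ge (ha.le_of_le ⟨hw, huw⟩ hwa.le)

theorem exists_le_covBy (hc : IsMaxChain (· ≤ ·) c) {u v : L} (hu : u ∈ c) (hv : v ∈ c)
    (huv : u < v) : ∃ a ∈ c, a ⋖ v ∧ u ≤ a := by
  obtain ⟨a, ha, h1, h2⟩ := hc.dual.exists_covBy_le (u := OrderDual.toDual v)
    (v := OrderDual.toDual u) hv hu huv
  exact ⟨OrderDual.ofDual a, ha, h1.ofDual, h2⟩

end IsMaxChain

theorem IsChain.exists_ltSeries {L : Type u} [PartialOrder L] [Finite L] {c : Set L}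
    (hc : IsChain (· ≤ ·) c) {n : ℕ} (hn : c.ncard = n + 1) :
    ∃ p : LTSeries L, p.length = n := by
  classical
  let := hc.linearOrder
  let := Fintype.ofFinite c
  have hcard : Fintype.card c = n + 1 := by
    rw [← hn, ← Nat.card_coe_set_eq, Nat.card_eq_fintype_card]
  let e := Fintype.orderIsoFinOfCardEq c hcard
  refine ⟨LTSeries.mk n (fun i => (e i : L)) fun i j hij => ?_, rfl⟩
  exact (Subtype.coe_lt_coe (p := (· ∈ c))).2 (e.strictMono hij)

/-! ### Join-irreducible elements and chains -/

section JoinIrreducible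

variable {L : Type u} [Lattice L]

/-- Elements that are minimal among those below `c` but not below `b` are join-irreducible. -/
theorem Minimal.mem_joinIrreducibles {b c j : L}
    (hj : Minimal (fun k => k ≤ c ∧ ¬ k ≤ b) j) : j ∈ joinIrreducibles L := by
  have hlt : ∀ p, p < j → p ≤ b := fun p hp => by
    by_contra h
    exact hj.not_prop_of_lt hp ⟨hp.le.trans hj.prop.1, h⟩
  have hbj : b ⊓ j < j := lt_of_le_of_ne inf_le_right fun h => hj.prop.2 (inf_eq_right.1 h)
  refine ⟨b ⊓ j, ⟨hbj, fun w hw hwj => ?_⟩, fun x hx => ?_⟩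
  · exact hw.not_ge (le_inf (hlt w hwj) hwj.le)
  · exact hx.eq_or_eq (le_inf (hlt x hx.lt) hx.le) inf_le_right |>.resolve_right hbj.ne |>.symm

variable [Finite L]

theorem exists_minimal_le_not_le {b c : L} (h : ¬ c ≤ b) :
    ∃ j, Minimal (fun k => k ≤ c ∧ ¬ k ≤ b) j := by
  obtain ⟨j, -, hj⟩ := (Set.toFinite {k : L | k ≤ c ∧ ¬ k ≤ b}).exists_le_minimal
    (show c ∈ {k : L | k ≤ c ∧ ¬ k ≤ b} from ⟨le_rfl, h⟩)
  exact ⟨j, hj⟩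

/-- Along a chain, each step creates a new join-irreducible element. -/
theorem LTSeries.exists_injective_joinIrreducibles (p : LTSeries L) :
    ∃ φ : Fin p.length → joinIrreducibles L, Function.Injective φ ∧
      ∀ i, Minimal (fun k => k ≤ p i.succ ∧ ¬ k ≤ p i.castSucc) (φ i : L) := by
  have h : ∀ i : Fin p.length, ∃ j, Minimal (fun k => k ≤ p i.succ ∧ ¬ k ≤ p i.castSucc) j :=
    fun i => exists_minimal_le_not_le (p.strictMono Fin.castSucc_lt_succ).not_ge
  choose φ hφ using h
  refine ⟨fun i => ⟨φ i, (hφ i).mem_joinIrreducibles⟩, ?_, hφ⟩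
  have hne : ∀ i j, i < j → φ i ≠ φ j := fun i j hij he =>
    (hφ j).prop.2 (he ▸ (hφ i).prop.1.trans (p.monotone (Fin.succ_le_castSucc_iff.2 hij)))
  intro i j hij
  by_contra h
  have hij' : φ i = φ j := congrArg Subtype.val hij
  rcases lt_or_gt_of_ne h with h | h
  · exact hne i j h hij'
  · exact hne j i h hij'.symm

theorem krullDim_le_ncard_joinIrreducibles :
    Order.krullDim L ≤ ((joinIrreducibles L).ncard : WithBot ℕ∞) := by
  refine iSup_le fun p => ?_
  obtain ⟨φ, hφ, -⟩ := p.exists_injective_joinIrreducibles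
  have := Nat.card_le_card_of_injective φ hφ
  rw [Nat.card_fin, Nat.card_coe_set_eq] at this
  exact_mod_cast this

theorem ncard_le_of_krullDim_le {n : ℕ} (h : Order.krullDim L ≤ (n : WithBot ℕ∞)) {c : Set L}
    (hc : IsChain (· ≤ ·) c) : c.ncard ≤ n + 1 := by
  by_contra! hn
  obtain ⟨m, hm⟩ : ∃ m, c.ncard = m + 1 := ⟨c.ncard - 1, by omega⟩
  obtain ⟨p, hp⟩ := hc.exists_ltSeries hm
  have h1 := (Order.LTSeries.length_le_krullDim p).trans h
  have h2 : p.length ≤ n := by exact_mod_cast h1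
  omega

/-- The extremal meet semidistributive lattices are left modular. -/
theorem IsExtremal.isLeftModularLattice (hM : IsMeetSemidistributive L) (h : IsExtremal L) :
    IsLeftModularLattice L := by
  obtain ⟨p, hp⟩ := Order.le_krullDim_iff.1 h.1.ge
  obtain ⟨φ, hφ, hmin⟩ := p.exists_injective_joinIrreducibles
  have hcard : Nat.card (Fin p.length) = Nat.card (joinIrreducibles L) := by
    rw [Nat.card_fin, Nat.card_coe_set_eq, hp]
  have hsurj : Function.Surjective φ :=
    ((Nat.bijective_iff_injective_and_card φ).2 ⟨hφ, hcard⟩).2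
  have hchain : IsChain (· ≤ ·) (Set.range p) := p.monotone.isChain_range
  -- A chain with the largest possible number of elements, length plus one, cannot be enlarged.
  have hmax : IsMaxChain (· ≤ ·) (Set.range p) := by
    refine ⟨hchain, fun d hd hsub => ?_⟩
    refine Set.eq_of_subset_of_ncard_le hsub ?_
    have h1 := ncard_le_of_krullDim_le h.1.le hd
    have h2 : (Set.range p).ncard = p.length + 1 := by
      rw [← Nat.card_coe_set_eq, Nat.card_range_of_injective p.strictMono.injective, Nat.card_fin]
    omega
  refine ⟨Flag.ofIsMaxChain _ hmax, ?_⟩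
  rintro _ ⟨i, rfl⟩ b c hbc
  set x := p i with hx
  have hle : b ⊔ (x ⊓ c) ≤ (b ⊔ x) ⊓ c :=
    le_inf (sup_le_sup_left inf_le_left _) (sup_le hbc.le inf_le_right)
  by_contra hne
  have hnle : ¬ (b ⊔ x) ⊓ c ≤ b ⊔ (x ⊓ c) := fun h => hne (le_antisymm h hle)
  obtain ⟨j, hj⟩ := exists_minimal_le_not_le hnle
  obtain ⟨k, hk⟩ := hsurj ⟨j, hj.mem_joinIrreducibles⟩
  have hjk := hmin k
  rw [hk] at hjk
  change Minimal _ j at hjk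
  have hjx : ¬ j ≤ x := fun hjx =>
    hj.prop.2 ((le_inf hjx (hj.prop.1.trans inf_le_right)).trans le_sup_right)
  -- `j` enters the chain at step `k` and is not below `x`, so `x` lies at or before the start of
  -- that step.
  have hik : x ≤ p k.castSucc := by
    apply p.monotone
    by_contra! hlt
    exact hjx (hjk.prop.1.trans (p.monotone (Fin.castSucc_lt_iff_succ_le.1 hlt)))
  -- Everything strictly below `j` is below both `b₁` and `b₂`, so `j` has the same meet with each.
  have key : ∀ {b₁ c₁ b₂ c₂ : L}, Minimal (fun k => k ≤ c₁ ∧ ¬ k ≤ b₁) j →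
      Minimal (fun k => k ≤ c₂ ∧ ¬ k ≤ b₂) j → j ⊓ b₁ ≤ j ⊓ b₂ := by
    intro b₁ c₁ b₂ c₂ h₁ h₂
    refine le_inf inf_le_left ?_
    by_contra hn
    have hlt : j ⊓ b₁ < j := lt_of_le_of_ne inf_le_left fun h => h₁.prop.2 (inf_eq_left.1 h)
    exact h₂.not_prop_of_lt hlt ⟨hlt.le.trans h₂.prop.1, hn⟩
  have hsd := hM j _ _ (le_antisymm (key hj hjk) (key hjk hj))
  rw [inf_eq_left.2] at hsd
  · exact hj.prop.2 (inf_eq_left.1 hsd.symm)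
  · exact hj.prop.1.trans (inf_le_left.trans
      (sup_le (le_sup_left.trans le_sup_left) (hik.trans le_sup_right)))

end JoinIrreducible

/-! ### Words of saturated chains -/

section LabelWord

variable {L : Type u} [Lattice L] {P : Type} (γ : CoverEdge L → P)

theorem labelWord_singleton (x : L) :
    labelWord γ (RelSeries.singleton _ x) = [] := rfl

theorem labelWord_cons (t : SaturatedChain L) (x : L) (h : x ⋖ t.head) :
    labelWord γ (t.cons x h) = γ ⟨(x, t.head), h⟩ :: labelWord γ t := by
  have hlen : (t.cons x h).length = t.length + 1 := by
    simp [RelSeries.cons, RelSeries.append, add_comm]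
  have hget : ∀ i : Fin (t.length + 1), (t.cons x h) (Fin.cast (by rw [hlen]) i.succ) = t i :=
    fun i => RelSeries.cons_cast_succ t x h i
  unfold labelWord
  rw [List.ofFn_congr hlen, List.ofFn_succ]
  refine congrArg₂ _ ?_ (congrArg _ (funext fun i => ?_))
  · congr 1
  · congr 1
    refine Subtype.ext (Prod.ext ?_ ?_)
    · exact hget i.castSucc
    · exact hget i.succ

theorem SaturatedChain.head_le_last (t : SaturatedChain L) : t.head ≤ t.last := by
  induction t using RelSeries.inductionOn with
  | singleton x => exact le_rfl
  | cons t x hx ih =>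
    rw [RelSeries.head_cons, RelSeries.last_cons]
    exact (CovBy.le hx).trans ih

theorem SaturatedChain.eq_singleton_or_cons (t : SaturatedChain L) :
    (∃ x, t = RelSeries.singleton _ x) ∨
      ∃ (t' : SaturatedChain L) (x : L) (h : x ⋖ t'.head), t = t'.cons x h := by
  induction t using RelSeries.inductionOn with
  | singleton x => exact Or.inl ⟨x, rfl⟩
  | cons t x hx _ => exact Or.inr ⟨t, x, hx, rfl⟩

theorem SaturatedChain.exists_eq_cons {t : SaturatedChain L} (h : t.head < t.last) :
    ∃ (t' : SaturatedChain L) (x : L) (h : x ⋖ t'.head), t = t'.cons x h := by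
  rcases t.eq_singleton_or_cons with ⟨x, rfl⟩ | h'
  · exact absurd h (lt_irrefl _)
  · exact h'

theorem SaturatedChain.eq_singleton {t : SaturatedChain L} (h : t.head = t.last) :
    t = RelSeries.singleton _ t.head := by
  rcases t.eq_singleton_or_cons with ⟨x, rfl⟩ | ⟨t', x, hx, rfl⟩
  · rfl
  · rw [RelSeries.head_cons, RelSeries.last_cons] at h
    exact absurd (h ▸ SaturatedChain.head_le_last t') hx.lt.not_ge

theorem mem_labelWord {t : SaturatedChain L} {p : P} (hp : p ∈ labelWord γ t) :
    ∃ (u v : L) (h : u ⋖ v), t.head ≤ u ∧ v ≤ t.last ∧ p = γ ⟨(u, v), h⟩ := by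
  induction t using RelSeries.inductionOn with
  | singleton x => simp [labelWord_singleton] at hp
  | cons t x hx ih =>
    rw [labelWord_cons, List.mem_cons] at hp
    rw [RelSeries.head_cons, RelSeries.last_cons]
    rcases hp with hp | hp
    · exact ⟨x, t.head, hx, le_rfl, SaturatedChain.head_le_last t, hp⟩
    · obtain ⟨u, v, h, hu, hv, rfl⟩ := ih hp
      exact ⟨u, v, h, (CovBy.le hx).trans hu, hv, rfl⟩

end LabelWord

/-! ### Left modular lattices are EL-shellable -/

section LeftModular

variable {L : Type u} [Lattice L]

/-- In an interval `[y, z]`, joining with `y` and meeting with `z` turns a cover relation between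
left modular elements into a cover relation or an equality. -/
theorem IsLeftModularElement.covBy_sup_inf {a a' y z : L} (ha : IsLeftModularElement a)
    (ha' : IsLeftModularElement a') (hcov : a ⋖ a') (hyz : y ≤ z) (hy : a ⊓ z ≤ y)
    (hy' : ¬ a' ⊓ z ≤ y) : y ⋖ y ⊔ (a' ⊓ z) := by
  refine ⟨left_lt_sup.2 hy', fun w hyw hw => ?_⟩
  have hwz : w ≤ z := hw.le.trans (sup_le hyz inf_le_right)
  have hwa : w ≤ y ⊔ a' := hw.le.trans (sup_le_sup_left inf_le_left _)
  -- Equality would give `w = y ⊔ (a ⊓ w)` by left modularity of `a`, and `a ⊓ w ≤ a ⊓ z ≤ y`.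
  have hm : y ⊔ a < w ⊔ a := by
    refine lt_of_le_of_ne (sup_le_sup_right hyw.le _) fun h => ?_
    have hyw' := ha y w hyw
    rw [h, inf_eq_right.2 le_sup_left] at hyw'
    refine hyw.not_ge (hyw'.trans_le (sup_le le_rfl ((inf_le_inf_left a hwz).trans hy)))
  -- Left modularity of `a'` on the pair `y ⊔ a < w ⊔ a` shows that `a' ⊓ (w ⊔ a)` is not `a`; as `a
  -- ⋖ a'`, it is `a'`.
  have hwa' : a' ≤ w ⊔ a := by
    have h1 := ha' _ _ hm
    have h2 : y ⊔ a ⊔ a' = y ⊔ a' := by rw [sup_assoc, sup_eq_right.2 hcov.le]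
    rw [h2, inf_eq_right.2 (sup_le hwa (hcov.le.trans le_sup_right))] at h1
    rcases hcov.eq_or_eq (le_inf hcov.le le_sup_right : a ≤ a' ⊓ (w ⊔ a)) inf_le_left with h | h
    · rw [h, sup_assoc, sup_idem] at h1
      exact absurd h1 hm.ne'
    · exact inf_eq_left.1 h
  rcases hwz.lt_or_eq with hlt | rfl
  · have h1 := ha w z hlt
    have h2 : a' ⊓ z ≤ w := by
      calc a' ⊓ z ≤ (w ⊔ a) ⊓ z := inf_le_inf_right _ hwa'
        _ = w ⊔ (a ⊓ z) := h1
        _ ≤ w := sup_le le_rfl (hy.trans hyw.le)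
    exact hw.not_ge (sup_le hyw.le h2)
  · exact hw.not_ge (sup_le hyz inf_le_right)

/-- The labelling of the cover relations `u ⋖ v` by the number of elements `a` of a given chain
with `a ⊓ v ≤ u`. -/
noncomputable def Flag.coverLabel (F : Flag L) (e : CoverEdge L) : ℕ :=
  {a | a ∈ F ∧ a ⊓ e.1.2 ≤ e.1.1}.ncard

/-- The relation `a ⊓ v ≤ u` composes along a chain. It is used to rule out increasing chains
through a wrong atom. -/
theorem SaturatedChain.inf_last_le_head {t : SaturatedChain L} {P : Type}
    {γ : CoverEdge L → P} {a : L} {p : P → Prop} (h : ∀ e, p (γ e) → a ⊓ e.1.2 ≤ e.1.1)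
    (ht : ∀ q ∈ labelWord γ t, p q) : a ⊓ t.last ≤ t.head := by
  induction t using RelSeries.inductionOn with
  | singleton x => exact inf_le_right
  | cons t x hx ih =>
    rw [labelWord_cons] at ht
    rw [RelSeries.head_cons, RelSeries.last_cons]
    have h1 := ih fun q hq => ht q (List.mem_cons_of_mem _ hq)
    have h2 := h _ (ht _ List.mem_cons_self)
    exact (le_inf inf_le_left h1).trans h2

variable [Finite L]

/-- The elements counted by a label form an initial segment of the flag, so a single threshold `a`
decides the comparison; likewise in `Flag.coverLabel_lt`. -/
theorem Flag.coverLabel_le (F : Flag L) {a : L} (ha : a ∈ F) {e e' : CoverEdge L}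
    (he : ∀ b ∈ F, b < a → b ⊓ e.1.2 ≤ e.1.1) (he' : ¬ a ⊓ e'.1.2 ≤ e'.1.1) :
    F.coverLabel e' ≤ F.coverLabel e := by
  refine Set.ncard_le_ncard fun b hb => ⟨hb.1, he b hb.1 ?_⟩
  rcases F.maxChain.lt_or_le hb.1 ha with h | h
  · exact h
  · exact absurd ((inf_le_inf_right _ h).trans hb.2) he'

theorem Flag.coverLabel_lt (F : Flag L) {a : L} (ha : a ∈ F) {e e' : CoverEdge L}
    (he : a ⊓ e.1.2 ≤ e.1.1) (he' : ¬ a ⊓ e'.1.2 ≤ e'.1.1) :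
    F.coverLabel e' < F.coverLabel e := by
  refine Set.ncard_lt_ncard ⟨fun b hb => ⟨hb.1, ?_⟩, fun h => he' (h ⟨ha, he⟩).2⟩
  rcases F.maxChain.le_or_le hb.1 ha with h | h
  · exact (inf_le_inf_right _ h).trans he
  · exact absurd ((inf_le_inf_right _ h).trans hb.2) he'

/-- The induction goes down from the larger elements `y`. The atom `s'` has a smaller label than all
other atoms of `[y, z]` and all cover relations of `[s', z]`. An increasing chain through another
atom has all labels above that of `s'`, whence `a ⊓ z` lies below that atom, and so does `s'`. -/
theorem Flag.isELLabelling_coverLabel (F : Flag L) (hF : ∀ a ∈ F, IsLeftModularElement a) :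
    IsELLabelling F.coverLabel := by
  intro y
  induction y using WellFoundedGT.induction with
  | ind y ih =>
  intro z hyz
  rcases hyz.eq_or_lt with rfl | hlt
  · refine ⟨RelSeries.singleton _ y, ⟨rfl, rfl⟩, List.isChain_nil, fun t ht ht' hne => ?_⟩
    exact absurd (SaturatedChain.eq_singleton (ht.trans ht'.symm)) (ht ▸ hne)
  obtain ⟨a, ⟨haF, hay⟩, hamin⟩ : ∃ a, Minimal (fun a => a ∈ F ∧ ¬ a ⊓ z ≤ y) a := by
    have : Nonempty L := ⟨y⟩
    let _ := Fintype.ofFinite L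
    let _ := Fintype.toBoundedOrder L
    obtain ⟨a, -, ha⟩ := (Set.toFinite {a : L | a ∈ F ∧ ¬ a ⊓ z ≤ y}).exists_le_minimal
      (show ⊤ ∈ {a : L | a ∈ F ∧ ¬ a ⊓ z ≤ y} from
        ⟨F.top_mem, fun h => hlt.not_ge (by rwa [top_inf_eq] at h)⟩)
    exact ⟨a, ha⟩
  have hamin' : ∀ b ∈ F, b < a → b ⊓ z ≤ y := fun b hb hba => by
    by_contra h
    exact hba.not_ge (hamin ⟨hb, h⟩ hba.le)
  set s' := y ⊔ (a ⊓ z) with hs'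
  have hs'z : s' ≤ z := sup_le hyz inf_le_right
  have has' : a ⊓ z ≤ s' := le_sup_right
  have hcov : y ⋖ s' := by
    obtain ⟨b, hb, hba⟩ : ∃ b ∈ F, b < a := by
      have : Nonempty L := ⟨y⟩
      let _ := Fintype.ofFinite L
      let _ := Fintype.toBoundedOrder L
      refine ⟨⊥, F.bot_mem, bot_lt_iff_ne_bot.2 fun h => hay ?_⟩
      rw [h, bot_inf_eq]
      exact bot_le
    obtain ⟨b', hb', hb'a, -⟩ := F.maxChain.exists_le_covBy hb haF hba
    exact (hF b' hb').covBy_sup_inf (hF a haF) hb'a hyz (hamin' b' hb' hb'a.lt) hay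
  have hna : ¬ a ⊓ s' ≤ y := fun h => hay ((le_inf inf_le_left has').trans h)
  have hlow : ∀ e : CoverEdge L, F.coverLabel ⟨(y, s'), hcov⟩ < F.coverLabel e →
      a ⊓ e.1.2 ≤ e.1.1 := by
    intro e he
    by_contra h
    refine he.not_ge (F.coverLabel_le haF (fun b hb hba => ?_) h)
    exact (inf_le_inf_left b hs'z).trans (hamin' b hb hba)
  have hatom : ∀ (t' : L) (ht' : y ⋖ t'), t' ≤ z → t' ≠ s' →
      F.coverLabel ⟨(y, s'), hcov⟩ < F.coverLabel ⟨(y, t'), ht'⟩ := by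
    intro t' ht' ht'z hne
    refine F.coverLabel_lt haF ?_ hna
    by_contra h
    have h1 : y ⊔ (a ⊓ t') = t' :=
      (ht'.eq_or_eq le_sup_left (sup_le ht'.le inf_le_right)).resolve_left (left_lt_sup.2 h).ne'
    have h2 : t' ≤ s' := h1 ▸ sup_le_sup_left (inf_le_inf_left a ht'z) y
    exact hne ((hcov.eq_or_eq ht'.le h2).resolve_left ht'.lt.ne')
  obtain ⟨s, ⟨hsh, hsl⟩, hsinc, hsuniq⟩ := ih s' hcov.lt z hs'z
  have hcov' : y ⋖ s.head := hsh.symm ▸ hcov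
  have hlab : F.coverLabel ⟨(y, s.head), hcov'⟩ = F.coverLabel ⟨(y, s'), hcov⟩ := by
    simp only [hsh]
  refine ⟨s.cons y hcov', ⟨RelSeries.head_cons .., by rw [RelSeries.last_cons, hsl]⟩, ?_, ?_⟩
  · unfold IsIncreasingChain
    rw [labelWord_cons, List.isChain_cons]
    refine ⟨fun q hq => ?_, hsinc⟩
    obtain ⟨u, v, h, hu, hv, rfl⟩ := mem_labelWord _ (List.mem_of_mem_head? hq)
    rw [hlab]
    refine (F.coverLabel_lt haF ?_ hna).le
    exact (inf_le_inf_left a (hv.trans hsl.le)).trans (has'.trans (hsh ▸ hu))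
  · intro t ht htl hne
    obtain ⟨t₁, x, hx, rfl⟩ := SaturatedChain.exists_eq_cons (t := t) (by rwa [ht, htl])
    rw [RelSeries.head_cons] at ht
    rw [RelSeries.last_cons] at htl
    subst ht
    have ht₁z : t₁.head ≤ z := htl ▸ SaturatedChain.head_le_last t₁
    unfold IsIncreasingChain
    rw [labelWord_cons, labelWord_cons, hlab]
    by_cases hh : t₁.head = s'
    · obtain ⟨h1, h2⟩ := hsuniq t₁ hh htl fun h => hne (by subst h; rfl)
      refine ⟨fun h => h1 (List.isChain_cons.1 h).2, ?_⟩
      simp only [hh]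
      exact List.Lex.cons h2
    · have hlt' := hatom _ hx ht₁z hh
      refine ⟨fun h => ?_, List.Lex.rel hlt'⟩
      have hpw := List.isChain_iff_pairwise.1 h
      have := SaturatedChain.inf_last_le_head hlow
        fun q hq => hlt'.trans_le (List.rel_of_pairwise_cons hpw hq)
      rw [htl] at this
      have h2 : s' ≤ t₁.head := sup_le (CovBy.le hx) this
      exact hh ((CovBy.eq_or_eq hx hcov.le h2).resolve_left hcov.lt.ne').symm

theorem IsLeftModularLattice.isELShellable (h : IsLeftModularLattice L) : IsELShellable L := by
  obtain ⟨F, hF⟩ := h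
  exact ⟨ℕ, inferInstance, F.coverLabel, F.isELLabelling_coverLabel hF⟩

end LeftModular

/-! ### EL-shellable lattices are shellable -/

section FirstAtom

variable {L : Type u} [Lattice L] {P : Type} [PartialOrder P]

/-- `x` is an atom of the interval `[u, v]`, and the label of `u ⋖ x` is strictly below the labels
of the cover relations from `u` to the other atoms of `[u, v]`. -/
def IsFirstAtom (γ : CoverEdge L → P) (u x v : L) : Prop :=
  ∃ h : u ⋖ x, x ≤ v ∧ ∀ (y : L) (h' : u ⋖ y), y ≤ v → y ≠ x → γ ⟨(u, x), h⟩ < γ ⟨(u, y), h'⟩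

variable {γ : CoverEdge L → P}

theorem IsFirstAtom.eq {u x y v : L} (hx : IsFirstAtom γ u x v) (hy : IsFirstAtom γ u y v) :
    x = y := by
  obtain ⟨h, hxv, hx⟩ := hx
  obtain ⟨h', hyv, hy⟩ := hy
  by_contra hne
  exact lt_asymm (hx y h' hyv (Ne.symm hne)) (hy x h hxv hne)

theorem isFirstAtom_self {u v : L} (h : u ⋖ v) : IsFirstAtom γ u v v :=
  ⟨h, le_rfl, fun _ h' hy hne =>
    absurd ((h.eq_or_eq h'.le hy).resolve_left h'.lt.ne') hne⟩

/-- For another atom `y`, the increasing chain of `[y, v]` preceded by `u` is lexicographically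
later. If the first labels agreed, its second label would be at least that of the increasing chain
of `[u, v]`, so it would be increasing as well, against uniqueness. -/
theorem IsELLabelling.isFirstAtom (hγ : IsELLabelling γ) {s : SaturatedChain L} {u : L}
    (h : u ⋖ s.head) (hinc : IsIncreasingChain γ (s.cons u h)) :
    IsFirstAtom γ u s.head s.last := by
  have hsl := SaturatedChain.head_le_last s
  refine ⟨h, hsl, fun y hy hyv hne => ?_⟩
  have hlt : s.head < s.last := lt_of_le_of_ne hsl fun he => hne
    ((h.eq_or_eq hy.le (he ▸ hyv)).resolve_left hy.lt.ne')
  obtain ⟨s', ⟨hs'h, hs'l⟩, -, hs'⟩ := hγ u s.last (h.le.trans hsl)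
  have hss' : s.cons u h = s' := by
    by_contra hn
    exact (hs' (s.cons u h) (RelSeries.head_cons ..) (RelSeries.last_cons ..) hn).1 hinc
  subst hss'
  obtain ⟨t, ⟨hth, htl⟩, htinc, -⟩ := hγ y s.last hyv
  subst hth
  obtain ⟨hninc, hlex⟩ := hs' (t.cons u hy) (RelSeries.head_cons ..)
    ((RelSeries.last_cons ..).trans htl) (fun he => hne (by
      have := congrArg RelSeries.toList he
      rw [RelSeries.toList_cons, RelSeries.toList_cons, List.cons.injEq] at this
      rw [RelSeries.toList_injective this.2]))
  unfold IsIncreasingChain at hinc hninc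
  rw [labelWord_cons] at hinc hninc
  rw [labelWord_cons, labelWord_cons] at hlex
  generalize γ ⟨(u, s.head), h⟩ = p at *
  generalize γ ⟨(u, t.head), hy⟩ = q at *
  cases hlex with
  | rel h => exact h
  | cons hlex =>
    exfalso
    obtain ⟨s₁, x, hx, rfl⟩ := SaturatedChain.exists_eq_cons hlt
    rw [labelWord_cons] at hlex hinc
    apply hninc
    rw [List.isChain_cons]
    refine ⟨fun r hr => ?_, htinc⟩
    have hpr := (List.isChain_cons_cons.1 hinc).1
    generalize labelWord γ t = l at hlex hr
    cases hlex with
    | rel h => 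
      simp only [List.head?_cons, Option.mem_def, Option.some.injEq] at hr
      exact hpr.trans (hr ▸ h.le)
    | cons h => 
      simp only [List.head?_cons, Option.mem_def, Option.some.injEq] at hr
      exact hr ▸ hpr

theorem IsELLabelling.exists_increasing (hγ : IsELLabelling γ) {u v : L} (huv : u < v) :
    ∃ (s : SaturatedChain L) (h : u ⋖ s.head), s.last = v ∧ IsIncreasingChain γ (s.cons u h) := by
  obtain ⟨s, ⟨hsh, hsl⟩, hinc, -⟩ := hγ u v huv.le
  obtain ⟨s, x, hx, rfl⟩ := SaturatedChain.exists_eq_cons (t := s) (by rwa [hsh, hsl])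
  rw [RelSeries.head_cons] at hsh
  rw [RelSeries.last_cons] at hsl
  subst hsh
  exact ⟨s, hx, hsl, hinc⟩

theorem IsELLabelling.exists_isFirstAtom (hγ : IsELLabelling γ) {u v : L} (huv : u < v) :
    ∃ x, IsFirstAtom γ u x v := by
  obtain ⟨s, h, rfl, hinc⟩ := hγ.exists_increasing huv
  exact ⟨_, hγ.isFirstAtom h hinc⟩

/-- If the first atoms of two overlapping intervals form a chain `u ⋖ x ⋖ y`, then this chain
starts the increasing chain of their union. -/
theorem IsELLabelling.isFirstAtom_trans (hγ : IsELLabelling γ) {u x y v : L}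
    (hxy : IsFirstAtom γ x y v) (hux : IsFirstAtom γ u x y) : IsFirstAtom γ u x v := by
  obtain ⟨s, h, rfl, hinc⟩ := hγ.exists_increasing (hxy.1.lt.trans_le hxy.2.1)
  obtain rfl := hxy.eq (hγ.isFirstAtom h hinc)
  obtain ⟨t, h', hty, htinc⟩ := hγ.exists_increasing (hux.1.lt.trans h.lt)
  have ht := hγ.isFirstAtom h' htinc
  rw [hty] at ht
  have hxt := hux.eq ht
  obtain ⟨t, z, hz, rfl⟩ := SaturatedChain.exists_eq_cons (t := t) (by rw [hty, ← hxt]; exact h.lt)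
  rw [RelSeries.last_cons] at hty
  rw [RelSeries.head_cons] at hxt
  subst hxt
  have hth : t.head = s.head :=
    (h.eq_or_eq (CovBy.le hz) (hty ▸ SaturatedChain.head_le_last t)).resolve_left hz.lt.ne'
  -- The increasing chain of `[u, s.head]` is `u ⋖ x ⋖ s.head`.
  have key : γ ⟨(u, x), hux.1⟩ ≤ γ ⟨(x, s.head), h⟩ := by
    unfold IsIncreasingChain at htinc
    rw [labelWord_cons, labelWord_cons] at htinc
    refine le_of_eq_of_le (congrArg γ ?_)
      ((List.isChain_cons_cons.1 htinc).1.trans_eq (congrArg γ ?_))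
    · exact Subtype.ext (Prod.ext rfl (RelSeries.head_cons t x hz).symm)
    · exact Subtype.ext (Prod.ext rfl hth)
  have hcov : u ⋖ (s.cons x h).head := by rw [RelSeries.head_cons]; exact hux.1
  have hinc' : IsIncreasingChain γ ((s.cons x h).cons u hcov) := by
    unfold IsIncreasingChain at hinc ⊢
    rw [labelWord_cons] at hinc ⊢
    rw [labelWord_cons, List.isChain_cons_cons]
    refine ⟨le_of_eq_of_le (congrArg γ ?_) key, hinc⟩
    exact Subtype.ext (Prod.ext rfl (RelSeries.head_cons s x h))
  have := hγ.isFirstAtom hcov hinc'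
  rwa [RelSeries.head_cons, RelSeries.last_cons] at this

/-- A maximal chain that has a first atom at each of its short steps in `[u, v]` starts with the
first atom of `[u, v]`. -/
theorem IsELLabelling.isFirstAtom_of_forall [Finite L] (hγ : IsELLabelling γ) {c : Set L}
    (hc : IsMaxChain (· ≤ ·) c) {u v : L} (hv : v ∈ c)
    (hfirst : ∀ p ∈ c, ∀ x ∈ c, ∀ q ∈ c, p ⋖ x → x ⋖ q → u ≤ p → q ≤ v → IsFirstAtom γ p x q) :
    ∀ p ∈ c, ∀ x ∈ c, u ≤ p → p ⋖ x → x ≤ v → IsFirstAtom γ p x v := by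
  intro p
  induction p using WellFoundedGT.induction with
  | ind p ih =>
  intro hp x hx hup hpx hxv
  rcases hxv.eq_or_lt with rfl | hlt
  · exact isFirstAtom_self hpx
  · obtain ⟨q, hq, hxq, hqv⟩ := hc.exists_covBy_le hx hv hlt
    exact hγ.isFirstAtom_trans (ih x hpx.lt hx q hq (hup.trans hpx.le) hxq hqv)
      (hfirst p hp x hx q hq hpx hxq hup hqv)

end FirstAtom

/-! ### Exchanges in maximal chains and the listing of facets. -/

section Shelling

variable {L : Type u} [Lattice L] {P : Type} [PartialOrder P]

/-- Two maximal chains agree up to some element `u`, and then the first one continues along a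
cover relation with a strictly smaller label. -/
def LabelPrecedes (γ : CoverEdge L → P) (c d : Set L) : Prop :=
  ∃ (u a b : L) (ha : u ⋖ a) (hb : u ⋖ b), u ∈ c ∧ u ∈ d ∧ a ∈ c ∧ b ∈ d ∧
    (∀ w ≤ u, w ∈ c ↔ w ∈ d) ∧ γ ⟨(u, a), ha⟩ < γ ⟨(u, b), hb⟩

variable {γ : CoverEdge L → P}

theorem LabelPrecedes.irrefl {c : Set L} (hc : IsMaxChain (· ≤ ·) c) : ¬ LabelPrecedes γ c c := by
  rintro ⟨u, a, b, ha, hb, -, -, hac, hbc, -, hlt⟩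
  obtain rfl := hc.eq_of_covBy hac hbc ha hb
  exact lt_irrefl _ hlt

/-- The two divergence points are compared inside `d`. The lower one serves for `c` and `e`; if they
coincide, the label inequalities compose. -/
theorem LabelPrecedes.trans {c d e : Set L} (hd : IsMaxChain (· ≤ ·) d)
    (h₁ : LabelPrecedes γ c d) (h₂ : LabelPrecedes γ d e) : LabelPrecedes γ c e := by
  obtain ⟨u, a, b, ha, hb, huc, hud, hac, hbd, hcd, hlt⟩ := h₁
  obtain ⟨u', a', b', ha', hb', hu'd, hu'e, ha'd, hb'e, hde, hlt'⟩ := h₂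
  rcases (hd.lt_or_le hud hu'd).imp_right LE.le.eq_or_lt with h | heq | h
  · have hbu' : b ≤ u' := hd.le_of_covBy_of_lt hbd hu'd hb h
    exact ⟨u, a, b, ha, hb, huc, (hde u h.le).1 hud, hac, (hde b hbu').1 hbd,
      fun w hw => (hcd w hw).trans (hde w (hw.trans h.le)), hlt⟩
  · obtain rfl := heq.symm
    obtain rfl := hd.eq_of_covBy hbd ha'd hb ha'
    exact ⟨u, a, b', ha, hb', huc, hu'e, hac, hb'e,
      fun w hw => (hcd w hw).trans (hde w hw), hlt.trans hlt'⟩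
  · have hau : a' ≤ u := hd.le_of_covBy_of_lt ha'd hud ha' h
    exact ⟨u', a', b', ha', hb', (hcd u' h.le).2 hu'd, hu'e, (hcd a' hau).2 ha'd, hb'e,
      fun w hw => (hcd w (hw.trans h.le)).trans (hde w hw), hlt'⟩

/-- If the step `p ⋖ x ⋖ q` of a maximal chain is not increasing, then `x` can be exchanged in such
a way that the chain obtained precedes the given one. -/
theorem IsELLabelling.exists_labelPrecedes_of_not_isFirstAtom (hγ : IsELLabelling γ) {c : Set L}
    (hc : IsMaxChain (· ≤ ·) c) {p x q : L} (hp : p ∈ c) (hx : x ∈ c) (hq : q ∈ c) (hpx : p ⋖ x)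
    (hxq : x ⋖ q) (h : ¬ IsFirstAtom γ p x q) :
    ∃ d, IsMaxChain (· ≤ ·) d ∧ LabelPrecedes γ d c ∧ c \ {x} ⊆ d := by
  obtain ⟨y, hy⟩ := hγ.exists_isFirstAtom (hpx.lt.trans hxq.lt)
  have hyx : x ≠ y := fun h' => h (h' ▸ hy)
  obtain ⟨hpy, hyq, hmin⟩ := id hy
  have hcomp : ∀ w ∈ c \ {x}, w ≤ p ∨ q ≤ w := by
    rintro w ⟨hw, hwx⟩
    rcases hc.lt_or_le hp hw with h1 | h1
    · refine Or.inr (hc.le_of_covBy_of_lt hq hw hxq ?_)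
      exact lt_of_le_of_ne (hc.le_of_covBy_of_lt hx hw hpx h1) (Ne.symm hwx)
    · exact Or.inl h1
  have hchain : IsChain (· ≤ ·) (insert y (c \ {x})) :=
    (hc.1.mono Set.sdiff_subset).insert fun w hw _ => by
      rcases hcomp w hw with h1 | h1
      · exact Or.inr (h1.trans hpy.le)
      · exact Or.inl (hyq.trans h1)
  -- The element `y` need not be covered by `q`, so the exchanged chain may have to be refined above
  -- `y`.
  obtain ⟨d, hd, hsub⟩ := hchain.exists_maxChain
  have hsub' : c \ {x} ⊆ d := (Set.subset_insert _ _).trans hsub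
  have hpd : p ∈ d := hsub' ⟨hp, hpx.lt.ne⟩
  refine ⟨d, hd, ⟨p, y, x, hpy, hpx, hpd, hp, hsub (Set.mem_insert _ _), hx, fun w hw => ?_,
    hmin x hpx hxq.le hyx⟩, hsub'⟩
  refine ⟨fun hwd => hc.mem_of_comparable fun b hb => ?_,
    fun hwc => hsub' ⟨hwc, (hw.trans_lt hpx.lt).ne⟩⟩
  by_cases hbx : b = x
  · exact Or.inl (hbx ▸ hw.trans hpx.le)
  · exact hd.le_or_le hwd (hsub' ⟨hb, hbx⟩)

variable [Finite L]

/-- Two distinct maximal chains `c` and `d` agree up to some element `u`; the first common element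
`v` after the divergence bounds an interval in which they have no other common elements. -/
theorem IsMaxChain.exists_divergence {c d : Set L} (hc : IsMaxChain (· ≤ ·) c)
    (hd : IsMaxChain (· ≤ ·) d) (hcd : c ≠ d) :
    ∃ u v, u ∈ c ∧ u ∈ d ∧ v ∈ c ∧ v ∈ d ∧ u < v ∧ (∀ w ≤ u, w ∈ c ↔ w ∈ d) ∧
      (∀ w ∈ c, u < w → w < v → w ∉ d) ∧ (∀ a ∈ c, a ∈ d → ¬ u ⋖ a) := by
  have hne : Nonempty L := by
    by_contra hn
    rw [not_nonempty_iff] at hn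
    exact hcd (Subsingleton.elim _ _)
  let _ := Fintype.ofFinite L
  let _ := Fintype.toBoundedOrder L
  have agree_of : ∀ a ∈ c, a ∈ d → ∀ u ∈ c, u ∈ d → u ⋖ a → (∀ w ≤ u, w ∈ c ↔ w ∈ d) →
      ∀ w ≤ a, w ∈ c ↔ w ∈ d := by
    intro a hac had u huc hud hua hagree w hw
    rcases hw.eq_or_lt with rfl | hw
    · exact ⟨fun _ => had, fun _ => hac⟩
    · constructor <;> intro h
      · refine (hagree w ?_).1 h
        by_contra hn
        exact hw.not_ge (hc.le_of_covBy_of_lt hac h hua ((hc.lt_or_le huc h).resolve_right hn))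
      · refine (hagree w ?_).2 h
        by_contra hn
        exact hw.not_ge (hd.le_of_covBy_of_lt had h hua ((hd.lt_or_le hud h).resolve_right hn))
  obtain ⟨u, -, hu⟩ := (Set.toFinite {u | u ∈ c ∧ u ∈ d ∧ ∀ w ≤ u, w ∈ c ↔ w ∈ d}).exists_le_maximal
    (show ⊥ ∈ {u | u ∈ c ∧ u ∈ d ∧ ∀ w ≤ u, w ∈ c ↔ w ∈ d} from ⟨hc.bot_mem, hd.bot_mem,
      fun w hw => by rw [le_bot_iff.1 hw]; exact ⟨fun _ => hd.bot_mem, fun _ => hc.bot_mem⟩⟩)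
  obtain ⟨huc, hud, hagree⟩ := hu.prop
  have hutop : u < ⊤ := lt_top_iff_ne_top.2 fun h =>
    hcd (Set.ext fun w => hagree w (h ▸ le_top))
  obtain ⟨v, -, hv⟩ := (Set.toFinite {v | v ∈ c ∧ v ∈ d ∧ u < v}).exists_le_minimal
    (show ⊤ ∈ {v | v ∈ c ∧ v ∈ d ∧ u < v} from ⟨hc.top_mem, hd.top_mem, hutop⟩)
  refine ⟨u, v, huc, hud, hv.prop.1, hv.prop.2.1, hv.prop.2.2, hagree, fun w hw huw hwv hwd => ?_,
    fun a hac had hua => ?_⟩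
  · exact hv.not_prop_of_lt hwv ⟨hw, hwd, huw⟩
  · exact hua.lt.not_ge
      (hu.le_of_ge ⟨hac, had, agree_of a hac had u huc hud hua hagree⟩ hua.le)

/-- A maximal chain that does not precede the maximal chain `d` meets it in a set that is contained
in the intersection of `d` with a preceding chain that misses just one element of `d`. -/
theorem IsELLabelling.exists_labelPrecedes (hγ : IsELLabelling γ) {c d : Set L}
    (hc : IsMaxChain (· ≤ ·) c) (hd : IsMaxChain (· ≤ ·) d) (hcd : c ≠ d)
    (hn : ¬ LabelPrecedes γ d c) :
    ∃ e x, IsMaxChain (· ≤ ·) e ∧ LabelPrecedes γ e d ∧ x ∈ d ∧ x ∉ c ∧ d \ {x} ⊆ e := by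
  obtain ⟨u, v, hud, huc, hvd, hvc, huv, hagree, hdisj, hdiv⟩ := hd.exists_divergence hc hcd.symm
  obtain ⟨a, had, hua, hav⟩ := hd.exists_covBy_le hud hvd huv
  obtain ⟨b, hbc, hub, hbv⟩ := hc.exists_covBy_le huc hvc huv
  have hnot : ¬ IsFirstAtom γ u a v := by
    rintro ⟨h, -, hlt⟩
    exact hn ⟨u, a, b, hua, hub, hud, huc, had, hbc, hagree,
      hlt b hub hbv fun h => hdiv a had (h ▸ hbc) hua⟩
  -- Were all two-step pieces of `d` between `u` and `v` to begin with their first atoms,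
  -- `isFirstAtom_of_forall` would make `a` the first atom of `[u, v]`.
  have hex : ∃ p ∈ d, ∃ x ∈ d, ∃ q ∈ d, p ⋖ x ∧ x ⋖ q ∧ u ≤ p ∧ q ≤ v ∧
      ¬ IsFirstAtom γ p x q := by
    by_contra! hno
    exact hnot (hγ.isFirstAtom_of_forall hd hvd
      (fun p hp x hx q hq h1 h2 h3 h4 => hno p hp x hx q hq h1 h2 h3 h4) u hud a had le_rfl hua hav)
  obtain ⟨p, hp, x, hx, q, hq, hpx, hxq, hup, hqv, hpxq⟩ := hex
  obtain ⟨e, he, hed, hsub⟩ := hγ.exists_labelPrecedes_of_not_isFirstAtom hd hp hx hq hpx hxq hpxq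
  exact ⟨e, x, he, hed, hx, hdisj x hx (hup.trans_lt hpx.lt) (hxq.lt.trans_le hqv), hsub⟩

theorem isFacet_orderComplex_iff [Nonempty L] {F : Finset L} :
    IsFacet (orderComplex L) F ↔ IsMaxChain (· ≤ ·) (F : Set L) := by
  constructor
  · rintro ⟨⟨hne, hF⟩, hmax⟩
    refine ⟨hF, fun t ht hsub => hsub.antisymm ?_⟩
    have hfin := Set.toFinite t
    rw [← hfin.coe_toFinset] at ht hsub ⊢
    rw [Finset.coe_subset] at hsub
    exact Finset.coe_subset.2 (hmax ⟨hne.mono hsub, ht⟩ hsub)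
  · intro hF
    refine ⟨⟨Finset.coe_nonempty.1 (hF.nonempty_iff.1 inferInstance), hF.1⟩, fun G hG hsub => ?_⟩
    exact Finset.coe_subset.1 (hF.2 hG.2 (Finset.coe_subset.2 hsub)).ge

/-- A strict partial order on a finite type can be extended to a listing of its elements. -/
theorem exists_equiv_fin_of_strictOrder {Ω : Type u} [Finite Ω] (r : Ω → Ω → Prop)
    (hirr : ∀ a, ¬ r a a) (htr : ∀ a b c, r a b → r b c → r a c) :
    ∃ (n : ℕ) (e : Fin n ≃ Ω), ∀ i j, r (e i) (e j) → i < j := by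
  classical
  have hr : IsPartialOrder Ω (fun a b => a = b ∨ r a b) :=
    { refl := fun c => Or.inl rfl
      trans := by
        rintro c d e (rfl | h₁) (rfl | h₂)
        · exact Or.inl rfl
        · exact Or.inr h₂
        · exact Or.inr h₁
        · exact Or.inr (htr _ _ _ h₁ h₂)
      antisymm := by
        rintro c d (rfl | h₁) (h | h₂)
        · rfl
        · rfl
        · exact h.symm
        · exact absurd (htr _ _ _ h₁ h₂) (hirr _) }
  obtain ⟨s, hs, hrs⟩ := extend_partialOrder (fun a b => a = b ∨ r a b)
  let _ : LinearOrder Ω :=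
    { le := s
      le_refl := hs.refl
      le_trans := hs.trans
      le_antisymm := hs.antisymm
      le_total := hs.total
      toDecidableLE := Classical.decRel _ }
  let _ := Fintype.ofFinite Ω
  let e := Fintype.orderIsoFinOfCardEq Ω rfl
  refine ⟨Fintype.card Ω, e.toEquiv, fun i j h => ?_⟩
  have hle : i ≤ j := e.le_iff_le.1 (hrs _ _ (Or.inr h))
  exact lt_of_le_of_ne hle fun he => hirr (e j) (by rw [he] at h; exact h)

/-- `exists_labelPrecedes` encloses each face shared with an earlier facet in a shared face that
lacks just one vertex of the current facet, so the maximal shared faces have codimension one. -/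
theorem IsELShellable.isShellableLattice [Nonempty L] (h : IsELShellable L) :
    IsShellableLattice L := by
  classical
  obtain ⟨P, _, γ, hγ⟩ := h
  let Ω := {F : Finset L // IsMaxChain (· ≤ ·) (F : Set L)}
  obtain ⟨n, e, he⟩ := exists_equiv_fin_of_strictOrder
    (fun c d : Ω => LabelPrecedes γ (c.1 : Set L) d.1) (fun c => LabelPrecedes.irrefl c.2)
    (fun c d e => LabelPrecedes.trans d.2)
  refine ⟨n, fun i => (e i).1, fun i j h => e.injective (Subtype.ext h),
    fun G => ?_, fun j _ G hG => ?_⟩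
  · rw [isFacet_orderComplex_iff]
    exact ⟨fun h => ⟨e.symm ⟨G, h⟩, by simp⟩, fun ⟨i, hi⟩ => hi ▸ (e i).2⟩
  · obtain ⟨⟨hG₁, hG₂⟩, hmax⟩ := hG
    simp only [Set.mem_iUnion, Set.mem_ofPred_eq, Set.mem_Iio] at hG₁ hG₂
    obtain ⟨i, hij, hGi⟩ := hG₁
    obtain ⟨d, x, hd, hdj, hxj, hxi, hsub⟩ := hγ.exists_labelPrecedes (e i).2 (e j).2
      (fun h => hij.ne (e.injective (Subtype.ext (Finset.coe_injective h))))
      (fun h => hij.not_gt (he _ _ h))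
    have hfin := Set.toFinite d
    obtain ⟨k, hk⟩ := e.surjective ⟨hfin.toFinset, by rwa [hfin.coe_toFinset]⟩
    have hdk : ((e k).1 : Set L) = d := by rw [hk]; exact hfin.coe_toFinset
    have hkj : k < j := he _ _ (by rwa [hdk])
    have hGx : G ⊆ (e j).1.erase x := fun y hy =>
      Finset.mem_erase.2 ⟨fun h => hxi (h ▸ hGi hy), hG₂ hy⟩
    have hmem : (e j).1.erase x ⊆ (e k).1 := by
      rw [← Finset.coe_subset, Finset.coe_erase, hdk]
      exact hsub
    have hmem' : (e j).1.erase x ⊆ G := hmax (by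
      refine ⟨?_, Finset.erase_subset _ _⟩
      simp only [Set.mem_iUnion, Set.mem_ofPred_eq, Set.mem_Iio]
      exact ⟨k, hkj, hmem⟩) hGx
    rw [hGx.antisymm hmem']
    unfold faceDim
    have := Finset.card_erase_add_one (Finset.mem_coe.1 hxj)
    rw [← this]
    push_cast
    ring

end Shelling

/-! ### Shellable semidistributive lattices are extremal -/

section JoinLabel

variable {L : Type u} [Lattice L]

/-- `j` is the least element whose join with `u` is `x`. For a cover relation `u ⋖ x` of a join
semidistributive lattice this is the join-irreducible label of `u ⋖ x`. -/
def IsJoinLabel (u x j : L) : Prop := IsLeast {k | u ⊔ k = x} j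

/-- Join semidistributivity closes `{k | u ⊔ k = x}` under meets, so a minimal member is the least
one. -/
theorem IsJoinSemidistributive.exists_isJoinLabel [Finite L] (hL : IsJoinSemidistributive L)
    {u x : L} (h : u ≤ x) : ∃ j, IsJoinLabel u x j := by
  obtain ⟨j, -, hj⟩ := (Set.toFinite {k : L | u ⊔ k = x}).exists_le_minimal
    (show x ∈ {k : L | u ⊔ k = x} from sup_eq_right.2 h)
  have hju : u ⊔ j = x := hj.prop
  refine ⟨j, hju, fun k hk => ?_⟩
  have h1 : u ⊔ (j ⊓ k) = x := (hL u j k (hju.trans (Eq.symm hk))).trans hju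
  exact (hj.le_of_le h1 inf_le_left).trans inf_le_right

/-- Perspective cover relations have the same join label. -/
theorem IsJoinLabel.of_perspective [Finite L] (hL : IsJoinSemidistributive L) {u x z v j : L}
    (hux : u ⋖ x) (huz : u ≤ z) (hzv : z < v) (hxz : z ⊔ x = v) (hj : IsJoinLabel u x j) :
    IsJoinLabel z v j := by
  obtain ⟨k, hk⟩ := hL.exists_isJoinLabel hzv.le
  have hjz : z ⊔ j = v := by
    have hju : u ⊔ j = x := hj.1
    rw [← sup_eq_left.2 huz, sup_assoc, hju, hxz]
  have hkj : k ≤ j := hk.2 hjz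
  have hkz : z ⊔ k = v := hk.1
  have hjx : j ≤ x := le_sup_right.trans_eq hj.1
  -- As `k ≤ x` and `u ⋖ x`, the only alternative is `k ≤ u ≤ z`, which contradicts `z < v`.
  have huk : u ⊔ k = x := by
    refine (hux.eq_or_eq le_sup_left (sup_le hux.le (hkj.trans hjx))).resolve_left fun h => ?_
    rw [sup_eq_left] at h
    rw [sup_eq_left.2 (h.trans huz)] at hkz
    exact hzv.ne hkz
  rwa [← hkj.antisymm (hj.2 huk)]

theorem IsJoinLabel.eq {u x j k : L} (hj : IsJoinLabel u x j) (hk : IsJoinLabel u x k) : j = k :=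
  hj.unique hk

/-- Every join-irreducible element is the label of the cover relation below it. -/
theorem isJoinLabel_of_mem_joinIrreducibles [Finite L] {j : L} (hj : j ∈ joinIrreducibles L) :
    ∃ u, u ⋖ j ∧ IsJoinLabel u j j := by
  obtain ⟨u, hu, huniq⟩ := hj
  refine ⟨u, hu, sup_eq_right.2 hu.le, fun k hk => ?_⟩
  have hkj : k ≤ j := le_sup_right.trans_eq hk
  rcases hkj.eq_or_lt with rfl | hlt
  · exact le_rfl
  · obtain ⟨w, -, hw⟩ := (Set.toFinite {w : L | k ≤ w ∧ w < j}).exists_le_maximal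
      (show k ∈ {w : L | k ≤ w ∧ w < j} from ⟨le_rfl, hlt⟩)
    have hwj : w ⋖ j := ⟨hw.prop.2, fun y hwy hyj =>
      hwy.not_ge (hw.le_of_ge ⟨hw.prop.1.trans hwy.le, hyj⟩ hwy.le)⟩
    have hku : k ≤ u := huniq w hwj ▸ hw.prop.1
    exact absurd ((sup_eq_left.2 hku).symm.trans hk) hu.lt.ne

/-- The labels of the cover relations that occur in a chain. -/
def joinLabels (c : Set L) : Set L := {j | ∃ u ∈ c, ∃ x ∈ c, u ⋖ x ∧ IsJoinLabel u x j}

variable [Finite L]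

/-- If a maximal chain `d` contains all elements of the maximal chain `c` but `x`, then it has
all the labels of `c`. -/
theorem joinLabels_subset (hL : IsJoinSemidistributive L) {c d : Set L}
    (hc : IsMaxChain (· ≤ ·) c) (hd : IsMaxChain (· ≤ ·) d) {x : L}
    (hxd : x ∉ d) (hsub : c \ {x} ⊆ d) : joinLabels c ⊆ joinLabels d := by
  rintro j ⟨u, hu, v, hv, huv, hj⟩
  -- Only the two cover relations at `x` can be lost. The label of `p ⋖ x` returns on the last step
  -- of `d` in `[p, q]`, that of `x ⋖ q` on the first.
  have key : ∀ p q, p ∈ d → q ∈ d → p ⋖ x → x ⋖ q →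
      (IsJoinLabel p x j → j ∈ joinLabels d) ∧ (IsJoinLabel x q j → j ∈ joinLabels d) := by
    intro p q hp hq hpx hxq
    have hpq := hpx.lt.trans hxq.lt
    constructor
    · intro hj
      obtain ⟨z, hz, hzq, hpz⟩ := hd.exists_le_covBy hp hq hpq
      refine ⟨z, hz, q, hq, hzq, hj.of_perspective hL hpx hpz hzq.lt ?_⟩
      refine (hzq.eq_or_eq le_sup_left (sup_le hzq.le hxq.le)).resolve_left fun h => hxd ?_
      have := (hxq.eq_or_eq (sup_eq_left.1 h) hzq.le).resolve_right hzq.lt.ne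
      exact this ▸ hz
    · intro hj
      obtain ⟨y, hy, hpy, hyq⟩ := hd.exists_covBy_le hp hq hpq
      obtain ⟨k, hk⟩ := hL.exists_isJoinLabel hpy.le
      have hk' : IsJoinLabel x q k := by
        refine hk.of_perspective hL hpy hpx.le hxq.lt ?_
        refine (hxq.eq_or_eq le_sup_left (sup_le hxq.le hyq)).resolve_left fun h => hxd ?_
        have := (hpx.eq_or_eq hpy.le (sup_eq_left.1 h)).resolve_left hpy.lt.ne'
        exact this ▸ hy
      exact ⟨p, hp, y, hy, hpy, hj.eq hk' ▸ hk⟩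
  have : Nonempty L := ⟨x⟩
  let _ := Fintype.ofFinite L
  let _ := Fintype.toBoundedOrder L
  by_cases hux : u = x
  · subst hux
    obtain ⟨p, hp, hpu, -⟩ := hc.exists_le_covBy hc.bot_mem hu
      (bot_lt_iff_ne_bot.2 fun h => hxd (h ▸ hd.bot_mem))
    exact (key p v (hsub ⟨hp, hpu.ne⟩) (hsub ⟨hv, huv.ne'⟩) hpu huv).2 hj
  by_cases hvx : v = x
  · subst hvx
    obtain ⟨q, hq, hvq, -⟩ := hc.exists_covBy_le hv hc.top_mem
      (lt_top_iff_ne_top.2 fun h => hxd (h ▸ hd.top_mem))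
    exact (key u q (hsub ⟨hu, huv.ne⟩) (hsub ⟨hq, hvq.ne'⟩) huv hvq).1 hj
  · exact ⟨u, hsub ⟨hu, hux⟩, v, hsub ⟨hv, hvx⟩, huv, hj⟩

/-- A label is determined by the lower end of its cover relation in `c`, and this end is never `⊤`.
-/
theorem ncard_joinLabels_lt [Nonempty L] {c : Set L} (hc : IsMaxChain (· ≤ ·) c) :
    (joinLabels c).ncard < c.ncard := by
  let _ := Fintype.ofFinite L
  let _ := Fintype.toBoundedOrder L
  have h : ∀ j, j ∈ joinLabels c → ∃ u ∈ c, ∃ x ∈ c, u ⋖ x ∧ IsJoinLabel u x j := fun _ h => h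
  choose! f hf x hx hcov hlab using h
  have h1 : (joinLabels c).ncard ≤ (c \ {⊤}).ncard := by
    refine Set.ncard_le_ncard_of_injOn f
      (fun j hj => ⟨hf j hj, fun h => (hcov j hj).lt.not_ge ?_⟩) fun j hj k hk hjk => ?_
    · rw [Set.mem_singleton_iff.1 h]
      exact le_top
    · have hx' := hc.eq_of_covBy (hx j hj) (hx k hk) (hcov j hj) (hjk ▸ hcov k hk)
      exact (hlab j hj).eq (by rw [hjk, hx']; exact hlab k hk)
  exact h1.trans_lt (Set.ncard_sdiff_singleton_lt_of_mem hc.top_mem)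

/-- In a shelling, each facet but the first differs from some earlier facet, up to supersets, by
just one element. -/
theorem IsPureOfDim.exists_subset {V : Type u} [Finite V] {k : ℕ} {F : Fin k → Finset V}
    {j : Fin k} (hj : 0 < (j : ℕ))
    (h : IsPureOfDim ((⋃ i ∈ Set.Iio j, {G | G ⊆ F i}) ∩ {G | G ⊆ F j}) (faceDim (F j) - 1)) :
    ∃ i < j, ∃ x ∈ F j, (F j : Set V) \ {x} ⊆ F i := by
  obtain ⟨G, -, hG⟩ := (Set.toFinite
    ((⋃ i ∈ Set.Iio j, {G | G ⊆ F i}) ∩ {G | G ⊆ F j})).exists_le_maximal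
    -- The empty face is shared with the facet of index `0`, so a maximal shared face exists.
    (show ∅ ∈ _ by
      refine ⟨?_, Finset.empty_subset _⟩
      simp only [Set.mem_iUnion]
      exact ⟨⟨0, hj.trans j.2⟩, hj, Finset.empty_subset _⟩)
  have hdim := h G hG
  obtain ⟨hG₁, hG₂⟩ := hG.prop
  simp only [Set.mem_iUnion] at hG₁
  obtain ⟨i, hij, hGi⟩ := hG₁
  have hGi' : G ⊆ F i := hGi
  have hGj : G ⊆ F j := hG₂
  unfold faceDim at hdim
  have hcard : G.card + 1 = (F j).card := by omega
  classical
  have hsd : (F j \ G).card = 1 := by rw [Finset.card_sdiff_of_subset hGj]; omega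
  obtain ⟨x, hx⟩ := Finset.card_eq_one.1 hsd
  have hx' : x ∈ F j \ G := hx ▸ Finset.mem_singleton_self x
  refine ⟨i, hij, x, (Finset.mem_sdiff.1 hx').1, fun y hy => hGi' ?_⟩
  by_contra hyG
  have : y ∈ F j \ G := Finset.mem_sdiff.2 ⟨hy.1, hyG⟩
  rw [hx, Finset.mem_singleton] at this
  exact hy.2 this

/-- Along the shelling, each facet has its labels among those of an earlier one, hence among those
of the first. A join-irreducible labels the cover relation below it, which lies in some facet. -/
theorem IsShellableLattice.ncard_joinIrreducibles_le_krullDim [Nonempty L]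
    (hL : IsJoinSemidistributive L) (h : IsShellableLattice L) :
    ((joinIrreducibles L).ncard : WithBot ℕ∞) ≤ Order.krullDim L := by
  obtain ⟨k, F, hinj, hF, hpure⟩ := h
  have hmax : ∀ i, IsMaxChain (· ≤ ·) (F i : Set L) := fun i =>
    isFacet_orderComplex_iff.1 ((hF _).2 ⟨i, rfl⟩)
  have hex : ∀ c : Set L, IsChain (· ≤ ·) c → ∃ i, c ⊆ F i := by
    intro c hc
    obtain ⟨d, hd, hcd⟩ := hc.exists_maxChain
    have hfin := Set.toFinite d
    rw [← hfin.coe_toFinset] at hd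
    obtain ⟨i, hi⟩ := (hF _).1 (isFacet_orderComplex_iff.2 hd)
    exact ⟨i, by rw [hi, hfin.coe_toFinset]; exact hcd⟩
  obtain ⟨i₀, -⟩ := hex ∅ IsChain.empty
  let z : Fin k := ⟨0, i₀.pos⟩
  have hlab : ∀ i, joinLabels (F i : Set L) ⊆ joinLabels (F z : Set L) := by
    intro i
    induction i using WellFoundedLT.induction with
    | ind j ih =>
    rcases Nat.eq_zero_or_pos (j : ℕ) with h0 | hpos
    · rw [show j = z from Fin.ext h0]
    · obtain ⟨i, hij, x, hx, hsub⟩ := (hpure j hpos).exists_subset hpos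
      refine (joinLabels_subset hL (hmax j) (hmax i) (fun hxi => hij.ne ?_) hsub).trans (ih i hij)
      refine (hinj (Finset.coe_injective ((hmax j).2 (hmax i).1 fun y hy => ?_))).symm
      by_cases hyx : y = x
      · exact hyx ▸ hxi
      · exact hsub ⟨hy, hyx⟩
  have hJ : joinIrreducibles L ⊆ joinLabels (F z : Set L) := by
    intro j hj
    obtain ⟨u, hu, hlu⟩ := isJoinLabel_of_mem_joinIrreducibles hj
    obtain ⟨i, hi⟩ := hex {u, j} (IsChain.pair hu.le)
    exact hlab i ⟨u, hi (Set.mem_insert _ _), j, hi (Set.mem_insert_of_mem _ rfl), hu, hlu⟩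
  have hlt := (Set.ncard_le_ncard hJ).trans_lt (ncard_joinLabels_lt (hmax z))
  obtain ⟨m, hm⟩ : ∃ m, (F z : Set L).ncard = m + 1 := ⟨(F z : Set L).ncard - 1, by omega⟩
  obtain ⟨p, hp⟩ := (hmax z).1.exists_ltSeries hm
  refine le_trans ?_ (Order.LTSeries.length_le_krullDim p)
  have : (joinIrreducibles L).ncard ≤ p.length := by omega
  exact_mod_cast this

end JoinLabel

/-! ### Duality and the count of meet-irreducible elements. -/

section Dual

variable {L : Type u} [Lattice L]

theorem IsShellableLattice.orderDual (h : IsShellableLattice L) : IsShellableLattice Lᵒᵈ := by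
  obtain ⟨k, F, hinj, hF, hpure⟩ := h
  have hfaces : (orderComplex Lᵒᵈ).faces = (orderComplex L).faces :=
    Set.ext fun G => and_congr_right fun _ => ⟨fun h => h.symm, fun h => h.symm⟩
  have hfacet : ∀ G : Finset L, IsFacet (orderComplex Lᵒᵈ) G ↔ IsFacet (orderComplex L) G := by
    intro G
    unfold IsFacet
    rw [hfaces]
    exact Iff.rfl
  exact ⟨k, F, hinj, fun G => (hfacet G).trans (hF G), hpure⟩

theorem joinIrreducibles_orderDual : joinIrreducibles Lᵒᵈ = meetIrreducibles L :=
  Set.ext fun m => existsUnique_congr fun x =>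
    toDual_covBy_toDual_iff (α := L) (a := m) (b := x)

/-- Shellable semidistributive lattices are extremal. -/
theorem IsShellableLattice.isExtremal [Finite L] [Nonempty L] (hJ : IsJoinSemidistributive L)
    (hM : IsMeetSemidistributive L) (h : IsShellableLattice L) : IsExtremal L := by
  refine ⟨le_antisymm krullDim_le_ncard_joinIrreducibles
    (h.ncard_joinIrreducibles_le_krullDim hJ), ?_⟩
  have h1 := krullDim_le_ncard_joinIrreducibles (L := Lᵒᵈ)
  have h2 := h.orderDual.ncard_joinIrreducibles_le_krullDim hM.orderDual
  rw [Order.krullDim_orderDual, joinIrreducibles_orderDual] at h1 h2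
  exact le_antisymm h1 h2

end Dual

theorem mainTheorem1 (L : Type u) [Lattice L] [Finite L] (hL : IsCongruenceUniform L) :
    List.TFAE
      [IsExtremal L,
       IsLeftModularLattice L,
       IsELShellable L,
       IsShellableLattice L] := by
  have hne := hL.nonempty
  obtain ⟨hJ, hM⟩ := hL.semidistributive
  tfae_have 1 → 2 := fun h => h.isLeftModularLattice hM
  tfae_have 2 → 3 := fun h => h.isELShellable
  tfae_have 3 → 4 := fun h => h.isShellableLattice
  tfae_have 4 → 1 := fun h => h.isExtremal hJ hM
  tfae_finish
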